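/- For a positive integer $T$ and $\mu^*\in\mathbb R^T$ let $N(\mu^*,I_T)$ be the Gaussian distribution on $\mathbb R^T$ with mean $\mu^*$ and identity covariance. Given $n$ samples $c^{(1)},\dots,c^{(n)}\in\mathbb R^T$ and $\epsilon>0$, an $\epsilon$-corrupted version of them is any collection $x^{(1)},\dots,x^{(n)}\in\mathbb R^T$, listed in any order, obtained by replacing at most $\epsilon n$ of the samples by arbitrary points. An online estimator (for $n$ samples and $T$ rounds) outputs in round $t=1,\dots,T$ a number $\mu_t\in\mathbb R$ that is a measurable function of the coordinates $x^{(i)}_s$, $1\le i\le n$, $1\le s\le t$, revealed so far; let $\mu(x)=(\mu_1,\dots,\mu_T)$ denote the vector of its outputs. Theorem. There are universal constants $\epsilon_0,C,K>0$ and $k\in\mathbb N$ such that the following holds. Let $T$ be a positive integer, $0<\epsilon\le\epsilon_0$, $0<\tau<1$, and let $n$ be an integer with $$n\;\ge\;2^T\cdot K\,(T/\epsilon)^k\cdot\log(2/\tau).$$ Then there is an online estimator (depending only on $T,\epsilon,\tau,n$) that robustly estimates the mean of every $N(\mu^*,I_T)$, $\mu^*\in\mathbb R^T$, under $\epsilon$-corruption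 with $\ell_2$ error $C\epsilon$ and failure probability $\tau$: if $c^{(1)},\dots,c^{(n)}$ are i.i.d. samples from $N(\mu^*,I_T)$, then, except on an event of probability at most $\tau$, every $\epsilon$-corrupted version $x$ of $c^{(1)},\dots,c^{(n)}$ satisfies $\|\mu(x)-\mu^*\|_2\le C\epsilon$. -/

import Mathlib

open MeasureTheory ProbabilityTheory

/-- A (deterministic) online estimator for `n` samples in `T` rounds with one coordinate per round.
In round `t` it has seen coordinates `s ≤ t` of every sample, and nothing else, and from these it
outputs a real number. -/
structure OnlineEstimator (n T : ℕ) where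
  output : (t : Fin T) → (Fin n → Set.Iic t → ℝ) → ℝ
  measurable_output : ∀ t, Measurable (output t)

/-- The vector of all `T` outputs of an online estimator on the samples `x`. -/
def OnlineEstimator.estimate {n T : ℕ} (A : OnlineEstimator n T)
    (x : Fin n → EuclideanSpace ℝ (Fin T)) : EuclideanSpace ℝ (Fin T) :=
  WithLp.toLp 2 fun t => A.output t fun i s => x i s

/-- `x` is an `ε`-corrupted version of the samples `c`: up to `ε * n` of the `n` samples have been
replaced by arbitrary points. The samples form an unordered collection (with multiplicities), so
the adversary may also list them in any order. -/
def IsCorruption {α : Type*} {n : ℕ} (ε : ℝ) (c x : Fin n → α) : Prop :=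
  ∃ σ : Equiv.Perm (Fin n), (({i | x i ≠ c (σ i)} : Set (Fin n)).ncard : ℝ) ≤ ε * n

/-- `A` estimates the mean of `X` under `ε`-corruption in the `T`-round online setting with error
`err`, failure probability `τ` and sample complexity `n`: for `n` i.i.d. samples from `X`, except
with probability `τ`, the error is at most `err` whatever the adversary, who sees all clean samples,
does. (The measure of a set that is not measurable is its outer measure.) -/
def EstimatesMeanOnline {n T : ℕ} (A : OnlineEstimator n T)
    (X : Measure (EuclideanSpace ℝ (Fin T))) (ε err τ : ℝ) : Prop :=
  Measure.pi (fun _ : Fin n => X)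
      {c | ∃ x, IsCorruption ε c x ∧ err < ‖A.estimate x - ∫ y, y ∂X‖} ≤ ENNReal.ofReal τ

/-! In each round, the samples sharing a bit string are halved at a median of the new coordinate.
After T rounds all 2^T paths carry almost equally many samples, whatever the adversary does. The
thresholds form a predictable tree, and under the Gaussian its bit t has bias b_t = 1/2 - Φ(m_t -
μ_t), with m_t the threshold met. If the clean samples follow this law up to O(ε), the biased bits
are O(ε)-close to uniform in total variation (`sum_abs_biasDensity_sub_one_le`). The tree depends on
the data, so concentration must hold for all trees and sets of paths at once; rounding thresholds to
quantile bins makes a union bound possible (`measureReal_deviationEvent_le`).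

The heart is `sum_sq_le_of_bias`. Under the uniform measure the likelihood ratio D_t is a martingale
with increments ±2 b_t D_t, and D_t - 1 is O(ε) in L1. Its second moment is not controlled, so a
Huber function, quadratic near 0 and linear far out, serves as potential: its final mean is O(ε²),
and round t adds order β_t² when |b_t| ≥ β_t on half of the paths. Hence ∑ β_t² = O(ε²).

The output is the median of m_t over all paths. If it misses μ_t, half of the thresholds miss it at
least as far on the same side, so the sum of squares bounds the Euclidean error without a factor √T.
-/

/-! ### Sums over paths of a binary tree -/

section BinaryTree

variable {T : ℕ}

/-- The path `y` with its `t`-th bit flipped. -/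
def flipBit (t : Fin T) (y : Fin T → Bool) : Fin T → Bool := Function.update y t (!y t)

lemma flipBit_self (t : Fin T) (y : Fin T → Bool) : flipBit t y t = !y t := by
  simp [flipBit]

lemma flipBit_of_ne {s t : Fin T} (h : s ≠ t) (y : Fin T → Bool) : flipBit t y s = y s := by
  simp [flipBit, h]

lemma flipBit_involutive (t : Fin T) : Function.Involutive (flipBit t) := by
  intro y
  ext s
  by_cases h : s = t
  · subst h; simp [flipBit_self]
  · simp [flipBit_of_ne h]

lemma sum_flipBit (t : Fin T) (F : (Fin T → Bool) → ℝ) : ∑ y, F (flipBit t y) = ∑ y, F y :=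
  Equiv.sum_comp (flipBit_involutive t).toPerm F

lemma two_mul_sum_eq_sum_flipBit (t : Fin T) (F : (Fin T → Bool) → ℝ) :
    2 * ∑ y, F y = ∑ y, (F y + F (flipBit t y)) := by
  rw [Finset.sum_add_distrib, sum_flipBit, two_mul]

/-- `a t` depends only on the bits before time `t`. -/
def PathPredictable {α : Type*} (a : Fin T → (Fin T → Bool) → α) : Prop :=
  ∀ t y z, (∀ s < t, y s = z s) → a t y = a t z

/-- `a t` depends only on the bits up to and including time `t`. -/
def PathAdapted {α : Type*} (a : Fin T → (Fin T → Bool) → α) : Prop :=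
  ∀ t y z, (∀ s ≤ t, y s = z s) → a t y = a t z

lemma PathPredictable.flipBit {α : Type*} {a : Fin T → (Fin T → Bool) → α} (ha : PathPredictable a)
    (t : Fin T) (y : Fin T → Bool) : a t (flipBit t y) = a t y :=
  ha t _ _ fun _ hs => flipBit_of_ne hs.ne y

/-- The product of the first `k` factors of `a` along a path. -/
def prefixProd (a : Fin T → (Fin T → Bool) → ℝ) (k : ℕ) (y : Fin T → Bool) : ℝ :=
  ∏ t : Fin T, if t.val < k then a t y else 1

lemma prefixProd_zero (a : Fin T → (Fin T → Bool) → ℝ) (y : Fin T → Bool) :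
    prefixProd a 0 y = 1 := by simp [prefixProd]

lemma prefixProd_all (a : Fin T → (Fin T → Bool) → ℝ) (y : Fin T → Bool) :
    prefixProd a T y = ∏ t, a t y := by simp [prefixProd]

lemma prefixProd_succ (a : Fin T → (Fin T → Bool) → ℝ) (t : Fin T) (y : Fin T → Bool) :
    prefixProd a (t + 1) y = a t y * prefixProd a t y := by
  unfold prefixProd
  rw [← Finset.mul_prod_erase _ _ (Finset.mem_univ t),
    ← Finset.mul_prod_erase _ (fun s : Fin T => if s.val < t.val then a s y else 1)
      (Finset.mem_univ t)]
  simp only [lt_add_iff_pos_right, zero_lt_one, if_true, lt_irrefl, if_false, one_mul]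
  congr 1
  refine Finset.prod_congr rfl fun s hs => ?_
  have hne : s.val ≠ t.val := fun h => Finset.ne_of_mem_erase hs (Fin.ext h)
  have : s.val < t.val + 1 ↔ s.val < t.val := by omega
  simp only [this]

lemma prefixProd_flipBit {a : Fin T → (Fin T → Bool) → ℝ} (ha : PathAdapted a) (t : Fin T)
    (y : Fin T → Bool) : prefixProd a t (flipBit t y) = prefixProd a t y := by
  unfold prefixProd
  refine Finset.prod_congr rfl fun s _ => ?_
  split_ifs with h
  · refine ha s _ _ fun r hr => flipBit_of_ne ?_ y
    rintro rfl
    exact absurd h (not_lt.2 hr)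
  · rfl

lemma prefixProd_nonneg {a : Fin T → (Fin T → Bool) → ℝ} (ha : ∀ t y, 0 ≤ a t y) (k : ℕ)
    (y : Fin T → Bool) : 0 ≤ prefixProd a k y :=
  Finset.prod_nonneg fun t _ => by split_ifs; exacts [ha t y, zero_le_one]

/-- If the two weights below every node add up to at most `c`, then the path weights add up to at
most `c ^ T`. -/
lemma sum_prod_le {a : Fin T → (Fin T → Bool) → ℝ} (ha : PathAdapted a) (h0 : ∀ t y, 0 ≤ a t y)
    {c : ℝ} (hc : ∀ t y, a t y + a t (flipBit t y) ≤ c) : ∑ y, ∏ t, a t y ≤ c ^ T := by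
  -- A sum over full paths counts each prefix of length k exactly 2^(T-k) times; the powers of two
  -- compensate.
  have key : ∀ k ≤ T, 2 ^ k * ∑ y, prefixProd a k y ≤ 2 ^ T * c ^ k := by
    intro k
    induction k with
    | zero => intro _; simp [prefixProd_zero]
    | succ k ih =>
      intro hk
      have hstep : 2 * ∑ y, prefixProd a (k + 1) y ≤ c * ∑ y, prefixProd a k y := by
        rw [two_mul_sum_eq_sum_flipBit ⟨k, hk⟩, Finset.mul_sum]
        refine Finset.sum_le_sum fun y _ => ?_
        rw [prefixProd_succ a ⟨k, hk⟩, prefixProd_succ a ⟨k, hk⟩, prefixProd_flipBit ha,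
          ← add_mul]
        exact mul_le_mul_of_nonneg_right (hc _ _) (prefixProd_nonneg h0 _ _)
      rcases Nat.eq_zero_or_pos T with rfl | hT
      · omega
      have hc0 : 0 ≤ c :=
        (add_nonneg (h0 ⟨k, hk⟩ (fun _ => true)) (h0 _ _)).trans (hc ⟨k, hk⟩ (fun _ => true))
      calc 2 ^ (k + 1) * ∑ y, prefixProd a (k + 1) y
          = 2 ^ k * (2 * ∑ y, prefixProd a (k + 1) y) := by ring
        _ ≤ 2 ^ k * (c * ∑ y, prefixProd a k y) := by gcongr
        _ = c * (2 ^ k * ∑ y, prefixProd a k y) := by ring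
        _ ≤ c * (2 ^ T * c ^ k) := mul_le_mul_of_nonneg_left (ih (by omega)) hc0
        _ = 2 ^ T * c ^ (k + 1) := by ring
  have := key T le_rfl
  simp only [prefixProd_all] at this
  exact le_of_mul_le_mul_left this (by positivity)

/-- If the two weights below every node add up to `1`, then so do the path weights. -/
lemma sum_prod_eq_one {a : Fin T → (Fin T → Bool) → ℝ} (ha : PathAdapted a)
    (hc : ∀ t y, a t y + a t (flipBit t y) = 1) : ∑ y, ∏ t, a t y = 1 := by
  have key : ∀ k ≤ T, 2 ^ k * ∑ y, prefixProd a k y = 2 ^ T := by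
    intro k
    induction k with
    | zero => intro _; simp [prefixProd_zero]
    | succ k ih =>
      intro hk
      have hstep : 2 * ∑ y, prefixProd a (k + 1) y = ∑ y, prefixProd a k y := by
        rw [two_mul_sum_eq_sum_flipBit ⟨k, hk⟩]
        refine Finset.sum_congr rfl fun y _ => ?_
        rw [prefixProd_succ a ⟨k, hk⟩, prefixProd_succ a ⟨k, hk⟩, prefixProd_flipBit ha,
          ← add_mul, hc, one_mul]
      rw [← ih (by omega), ← hstep]
      ring
  have := key T le_rfl
  simp only [prefixProd_all] at this
  have h2 : (2 : ℝ) ^ T ≠ 0 := by positivity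
  exact mul_left_cancel₀ h2 (by rw [this, mul_one])

end BinaryTree

/-! ### Convexity of the Huber function -/

section Huber

/-- The Huber function: quadratic up to `l`, linear beyond. -/
noncomputable def huber (l x : ℝ) : ℝ := if |x| ≤ l then x ^ 2 / 2 else l * |x| - l ^ 2 / 2

lemma huber_zero {l : ℝ} (hl : 0 ≤ l) : huber l 0 = 0 := by simp [huber, hl]

lemma huber_le {l : ℝ} (hl : 0 ≤ l) (x : ℝ) : huber l x ≤ l * |x| := by
  unfold huber
  split_ifs with h
  · nlinarith [sq_abs x, abs_nonneg x]
  · nlinarith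

/-- The Huber function is the Legendre transform of u²/2 on [-l, l]; these supporting lines yield
both convexity estimates below. -/
lemma le_huber {l u : ℝ} (hu : |u| ≤ l) (x : ℝ) : u * x - u ^ 2 / 2 ≤ huber l x := by
  unfold huber
  split_ifs with h
  · nlinarith [sq_nonneg (x - u)]
  · push Not at h
    have h1 : u * x ≤ |u| * |x| := by rw [← abs_mul]; exact le_abs_self _
    nlinarith [sq_abs u, abs_nonneg u, mul_nonneg (sub_nonneg.2 hu) (sub_nonneg.2 h.le)]

lemma two_mul_huber_le {l : ℝ} (hl : 0 ≤ l) (x d : ℝ) :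
    2 * huber l x ≤ huber l (x + d) + huber l (x - d) := by
  by_cases h : |x| ≤ l
  · have h1 := le_huber h (x + d)
    have h2 := le_huber h (x - d)
    have h3 : huber l x = x ^ 2 / 2 := if_pos h
    nlinarith
  · have h3 : huber l x = l * |x| - l ^ 2 / 2 := if_neg h
    rcases abs_cases x with ⟨hx, _⟩ | ⟨hx, _⟩
    · have h1 := le_huber (abs_of_nonneg hl).le (x + d)
      have h2 := le_huber (abs_of_nonneg hl).le (x - d)
      rw [h3, hx]; nlinarith
    · have hl' : |-l| ≤ l := by rw [abs_neg, abs_of_nonneg hl]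
      have h1 := le_huber hl' (x + d)
      have h2 := le_huber hl' (x - d)
      rw [h3, hx]; nlinarith

/-- For e equal to d clipped to [-l/2, l/2], both slopes x ± e are admissible, and their supporting
lines gain 2ed - e² ≥ e². -/
lemma two_mul_huber_add_le {l x : ℝ} (hx : |x| ≤ l / 2) (d : ℝ) :
    2 * huber l x + min (d ^ 2) (l ^ 2 / 4) ≤ huber l (x + d) + huber l (x - d) := by
  have hl : 0 ≤ l := by linarith [abs_nonneg x]
  have h3 : huber l x = x ^ 2 / 2 := if_pos (by linarith)
  obtain ⟨e, he, hed, hm⟩ : ∃ e : ℝ, |e| ≤ l / 2 ∧ e ^ 2 ≤ e * d ∧ min (d ^ 2) (l ^ 2 / 4) ≤ e ^ 2 := by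
    by_cases hd : |d| ≤ l / 2
    · exact ⟨d, hd, by nlinarith, min_le_left _ _⟩
    · push Not at hd
      rcases abs_cases d with ⟨h, _⟩ | ⟨h, _⟩
      · exact ⟨l / 2, by rw [abs_of_nonneg (by linarith)], by nlinarith,
          (min_le_right _ _).trans (by nlinarith)⟩
      · exact ⟨-(l / 2), by rw [abs_neg, abs_of_nonneg (by linarith)], by nlinarith,
          (min_le_right _ _).trans (by nlinarith)⟩
  have h1 := le_huber (l := l) (u := x + e) (by linarith [abs_add_le x e]) (x + d)
  have h2 := le_huber (l := l) (u := x - e) (by linarith [abs_sub x e]) (x - d)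
  nlinarith

end Huber

/-! ### Biased bits close to uniform have small biases -/

section TreeBias

variable {T : ℕ}

/-- The sign `±1` of a bit. -/
def bitSign (b : Bool) : ℝ := if b then 1 else -1

lemma bitSign_not (b : Bool) : bitSign (!b) = -bitSign b := by cases b <;> simp [bitSign]

/-- The likelihood ratio with respect to the uniform measure on paths of the first `k` bits, when
the bit `t` is biased by `b t`. -/
def biasDensity (b : Fin T → (Fin T → Bool) → ℝ) (k : ℕ) (y : Fin T → Bool) : ℝ :=
  prefixProd (fun t y => 1 + 2 * (b t y * bitSign (y t))) k y

lemma PathPredictable.isAdapted_bias {b : Fin T → (Fin T → Bool) → ℝ} (hb : PathPredictable b) :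
    PathAdapted fun t y => 1 + 2 * (b t y * bitSign (y t)) := by
  intro t y z h
  simp only [h t le_rfl, hb t y z fun s hs => h s hs.le]

/-- The martingale step: given the earlier bits, the two values of bit t are equally likely and move
the density in opposite directions. -/
lemma two_mul_sum_biasDensity {b : Fin T → (Fin T → Bool) → ℝ} (hb : PathPredictable b) (t : Fin T)
    (F : ℝ → ℝ) :
    2 * ∑ y, F (biasDensity b (t + 1) y - 1) =
      ∑ y, (F (biasDensity b t y - 1 + 2 * b t y * biasDensity b t y) +
        F (biasDensity b t y - 1 - 2 * b t y * biasDensity b t y)) := by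
  rw [two_mul_sum_eq_sum_flipBit t]
  refine Finset.sum_congr rfl fun y _ => ?_
  have hD := prefixProd_flipBit hb.isAdapted_bias t y
  simp only [biasDensity, prefixProd_succ, hD, flipBit_self, hb.flipBit, bitSign_not]
  cases y t
  · rw [add_comm]
    simp only [bitSign]
    congr 2 <;> · simp; ring
  · simp only [bitSign]
    congr 2 <;> · simp; ring

/-- If a process of biased bits is close to uniform in total variation, then its typical biases are
small in Euclidean norm. -/
theorem sum_sq_le_of_bias {b : Fin T → (Fin T → Bool) → ℝ} (hb : PathPredictable b) {η : ℝ}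
    (hη : 0 < η) (hη1 : 40 * η ≤ 1)
    (hD : ∑ y, |biasDensity b T y - 1| ≤ 2 ^ T * η) {β : Fin T → ℝ} (hβ : ∀ t, 0 ≤ β t)
    (hβb : ∀ t, (2 : ℝ) ^ T ≤ 2 * (Finset.univ.filter fun y => β t ≤ |b t y|).card) :
    ∑ t, β t ^ 2 ≤ 320 * η ^ 2 := by
  -- Any l > 32η makes the cap l²/4 exceed the final bound 8lη, so the cap proves inactive; l ≤ 1
  -- gives D ≥ 1/2 wherever |D - 1| ≤ l/2.
  set l := 40 * η with hl
  have hl0 : 0 < l := by positivity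
  have hP : (0 : ℝ) < 2 ^ T := by positivity
  -- By convexity the L1 norm of a martingale does not decrease, so the bound at time T holds at all
  -- earlier times.
  have habs : ∀ j k, k + j = T → ∑ y, |biasDensity b k y - 1| ≤ 2 ^ T * η := by
    intro j
    induction j with
    | zero => rintro k rfl; exact hD
    | succ j ih =>
      intro k hk
      have h1 := ih (k + 1) (by omega)
      have h2 := two_mul_sum_biasDensity hb ⟨k, by omega⟩ (fun x => |x|)
      have h3 : 2 * ∑ y, |biasDensity b k y - 1| ≤ 2 * ∑ y, |biasDensity b (k + 1) y - 1| := by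
        rw [h2, Finset.mul_sum]
        refine Finset.sum_le_sum fun y _ => ?_
        simp only
        set x := biasDensity b k y - 1
        set d := 2 * b ⟨k, by omega⟩ y * biasDensity b k y
        have := abs_add_le (x + d) (x - d)
        rw [show x + d + (x - d) = 2 * x by ring, abs_mul, abs_two] at this
        exact this
      linarith
  -- By Markov, |D - 1| > l/2 on at most 2^T/20 paths, so at least a quarter of all paths have both
  -- D ≥ 1/2 and bias at least β t. There the increment 2bD is at least β t in absolute value.
  have hstep : ∀ t : Fin T, 2 ^ T / 8 * min (β t ^ 2) (l ^ 2 / 4) +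
      ∑ y, huber l (biasDensity b t y - 1) ≤ ∑ y, huber l (biasDensity b (t + 1) y - 1) := by
    intro t
    have h1 := habs (T - t) t (by omega)
    set m := min (β t ^ 2) (l ^ 2 / 4) with hm
    have hm0 : 0 ≤ m := by positivity
    let B := Finset.univ.filter fun y => l / 2 < |biasDensity b t y - 1|
    let S := Finset.univ.filter fun y => β t ≤ |b t y|
    have hB : (B.card : ℝ) ≤ 2 ^ T / 4 := by
      have : (B.card : ℝ) * (l / 2) ≤ ∑ y, |biasDensity b t y - 1| := by
        rw [← nsmul_eq_mul]
        refine (Finset.card_nsmul_le_sum B _ _ fun y hy => ?_).trans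
          (Finset.sum_le_sum_of_subset_of_nonneg (Finset.subset_univ _) fun _ _ _ => abs_nonneg _)
        exact (Finset.mem_filter.1 hy).2.le
      have h2 : (B.card : ℝ) * (20 * η) ≤ (2 ^ T / 20) * (20 * η) := by
        rw [hl] at this; nlinarith
      have := le_of_mul_le_mul_right h2 (by positivity)
      linarith
    have hS : (2 : ℝ) ^ T / 4 ≤ (S \ B).card := by
      have h3 : (S.card : ℝ) ≤ (S \ B).card + B.card := by
        exact_mod_cast Finset.card_le_card_sdiff_add_card
      have := hβb t
      change (2 : ℝ) ^ T ≤ 2 * (S.card : ℝ) at this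
      linarith
    have h4 : (S \ B).card * m ≤ ∑ y, (huber l (biasDensity b t y - 1 + 2 * b t y * biasDensity b t y) +
        huber l (biasDensity b t y - 1 - 2 * b t y * biasDensity b t y) -
          2 * huber l (biasDensity b t y - 1)) := by
      rw [← nsmul_eq_mul]
      refine (Finset.card_nsmul_le_sum (S \ B) _ _ fun y hy => ?_).trans
          (Finset.sum_le_sum_of_subset_of_nonneg (Finset.subset_univ _) fun y _ _ => ?_)
      · simp only [S, B, Finset.mem_sdiff, Finset.mem_filter, Finset.mem_univ, true_and,
          not_lt] at hy
        have h5 := two_mul_huber_add_le hy.2 (2 * b t y * biasDensity b t y)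
        have h6 : 1 / 2 ≤ biasDensity b t y := by
          have := (abs_le.1 hy.2).1
          linarith
        have h7 : β t ^ 2 ≤ (2 * b t y * biasDensity b t y) ^ 2 := by
          rw [sq_le_sq, abs_mul, abs_mul, abs_two, abs_of_nonneg (hβ t),
            abs_of_nonneg (by linarith : 0 ≤ biasDensity b t y)]
          nlinarith [abs_nonneg (b t y)]
        have h8 : m ≤ min ((2 * b t y * biasDensity b t y) ^ 2) (l ^ 2 / 4) :=
          min_le_min_right _ h7
        linarith
      · linarith [two_mul_huber_le hl0.le (biasDensity b t y - 1) (2 * b t y * biasDensity b t y)]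
    rw [Finset.sum_sub_distrib, ← two_mul_sum_biasDensity hb t (huber l), ← Finset.mul_sum] at h4
    nlinarith [mul_le_mul_of_nonneg_right hS hm0]
  have htel : ∀ k ≤ T, ∑ t : Fin T, (if t.val < k then 2 ^ T / 8 * min (β t ^ 2) (l ^ 2 / 4) else 0) ≤
      ∑ y, huber l (biasDensity b k y - 1) := by
    intro k
    induction k with
    | zero => intro _; simp [biasDensity, prefixProd_zero, huber_zero hl0.le]
    | succ k ih =>
      intro hk
      refine le_trans ?_ (hstep ⟨k, hk⟩)
      refine le_trans (le_of_eq ?_) (add_le_add le_rfl (ih (by omega)))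
      rw [← Finset.add_sum_erase _ _ (Finset.mem_univ (⟨k, hk⟩ : Fin T)),
        ← Finset.add_sum_erase _ (fun t : Fin T =>
          if t.val < k then 2 ^ T / 8 * min (β t ^ 2) (l ^ 2 / 4) else 0)
          (Finset.mem_univ (⟨k, hk⟩ : Fin T))]
      simp only [lt_add_iff_pos_right, zero_lt_one, if_true, lt_irrefl, if_false, zero_add]
      congr 1
      refine Finset.sum_congr rfl fun s hs => ?_
      have hne : s.val ≠ k := fun h => Finset.ne_of_mem_erase hs (Fin.ext h)
      have : s.val < k + 1 ↔ s.val < k := by omega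
      simp only [this]
  have hmain : 2 ^ T / 8 * ∑ t, min (β t ^ 2) (l ^ 2 / 4) ≤ 2 ^ T * (l * η) := by
    have h1 := htel T le_rfl
    simp only [Fin.is_lt, if_true, ← Finset.mul_sum] at h1
    refine h1.trans ?_
    calc ∑ y, huber l (biasDensity b T y - 1) ≤ ∑ y, l * |biasDensity b T y - 1| :=
          Finset.sum_le_sum fun y _ => huber_le hl0.le _
      _ = l * ∑ y, |biasDensity b T y - 1| := by rw [Finset.mul_sum]
      _ ≤ l * (2 ^ T * η) := by gcongr
      _ = 2 ^ T * (l * η) := by ring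
  have hsum : ∑ t, min (β t ^ 2) (l ^ 2 / 4) ≤ 320 * η ^ 2 := by
    have : 2 ^ T * ∑ t, min (β t ^ 2) (l ^ 2 / 4) ≤ 2 ^ T * (320 * η ^ 2) := by
      rw [hl] at hmain ⊢; linarith
    exact le_of_mul_le_mul_left this hP
  -- A capped term alone would contribute 400η² > 320η².
  have hmin : ∀ t, min (β t ^ 2) (l ^ 2 / 4) = β t ^ 2 := by
    intro t
    refine min_eq_left ?_
    by_contra h
    push Not at h
    have h1 := (Finset.single_le_sum (f := fun t => min (β t ^ 2) (l ^ 2 / 4))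
      (fun s _ => by positivity) (Finset.mem_univ t)).trans hsum
    rw [min_eq_right h.le, hl] at h1
    nlinarith [sq_pos_of_pos hη]
  simpa only [hmin] using hsum

end TreeBias

/-! ### Halving a finite set by an order relation -/

section Halving

variable {α : Type*}

lemma exists_upper_subset (f : α → ℝ) (S : Finset α) (r : ℕ) (hr : r ≤ S.card) :
    ∃ B ⊆ S, B.card = r ∧ ∀ i ∈ S, i ∉ B → ∀ j ∈ B, f i ≤ f j := by
  classical
  induction r with
  | zero => exact ⟨∅, by simp, by simp, by simp⟩
  | succ r ih =>
    obtain ⟨B, hBS, hB, h⟩ := ih (by omega)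
    have hne : (S \ B).Nonempty := by
      rw [← Finset.card_pos, Finset.card_sdiff_of_subset hBS]
      omega
    obtain ⟨k, hk, hmax⟩ := Finset.exists_max_image (S \ B) f hne
    rw [Finset.mem_sdiff] at hk
    refine ⟨insert k B, Finset.insert_subset hk.1 hBS, by
      rw [Finset.card_insert_of_notMem hk.2, hB], fun i hi hiB j hj => ?_⟩
    rw [Finset.mem_insert, not_or] at hiB
    rcases Finset.mem_insert.1 hj with rfl | hj
    · exact hmax i (Finset.mem_sdiff.2 ⟨hi, hiB.2⟩)
    · exact h i hi hiB.2 j hj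

/-- `p.1` is an upper half of `S` for the order relation `R`, and `p.2` separates it from the lower
half. -/
def IsHalving (R : α → α → Bool) (S : Finset α) (p : Finset α × α) : Prop :=
  p.1 ⊆ S ∧ p.1.card = S.card / 2 ∧ (∀ i ∈ S, i ∉ p.1 → R i p.2) ∧ ∀ i ∈ p.1, R p.2 i

lemma exists_isHalving [Nonempty α] (f : α → ℝ) (S : Finset α) :
    ∃ p, IsHalving (fun i j => decide (f i ≤ f j)) S p := by
  obtain ⟨B, hBS, hB, h⟩ := exists_upper_subset f S (S.card / 2) (Nat.div_le_self _ _)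
  rcases B.eq_empty_or_nonempty with rfl | hne
  · rcases S.eq_empty_or_nonempty with rfl | hS
    · exact ⟨(∅, Classical.arbitrary α), by simp [IsHalving]⟩
    · obtain ⟨k, hk, hmax⟩ := Finset.exists_max_image S f hS
      exact ⟨(∅, k), by simp, hB, fun i hi _ => by simpa using hmax i hi, by simp⟩
  · obtain ⟨k, hk, hmin⟩ := Finset.exists_min_image B f hne
    exact ⟨(B, k), hBS, hB, fun i hi hiB => by simpa using h i hi hiB k hk,
      fun i hi => by simpa using hmin i hi⟩

open Classical in
/-- A choice of a halving of `S` for `R`. -/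
noncomputable def halve [Nonempty α] (R : α → α → Bool) (S : Finset α) : Finset α × α :=
  if h : ∃ p, IsHalving R S p then h.choose else (∅, Classical.arbitrary α)

/-- The halving is chosen from the comparisons alone, never from the real values; this makes
arbitrary choices harmless for measurability. -/
lemma isHalving_halve [Nonempty α] {R : α → α → Bool} {f : α → ℝ}
    (hR : ∀ i j, R i j = decide (f i ≤ f j)) (S : Finset α) : IsHalving R S (halve R S) := by
  obtain rfl : R = fun i j => decide (f i ≤ f j) := by ext i j; rw [hR]
  have h := exists_isHalving f S
  rw [halve, dif_pos h]
  exact h.choose_spec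

end Halving

/-! ### The tree of successive halvings -/

section Labels

variable {α : Type*} [Fintype α] [Nonempty α]

open Classical in
/-- The bits that the samples have received before round `t`: in each round every cell, the set of
samples with a given bit string, is halved by the order of the new coordinate. -/
noncomputable def bits (R : ℕ → α → α → Bool) : ℕ → α → ℕ → Bool
  | 0 => fun _ _ => false
  | t + 1 => fun i => Function.update (bits R t i) t
      (decide (i ∈ (halve (R t) (Finset.univ.filter fun j => bits R t j = bits R t i)).1))

open Classical in
/-- The samples with bit string `v` before round `t`. -/
noncomputable def cell (R : ℕ → α → α → Bool) (t : ℕ) (v : ℕ → Bool) : Finset α :=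
  Finset.univ.filter fun j => bits R t j = v

/-- The sample separating the two halves of a cell. -/
noncomputable def splitter (R : ℕ → α → α → Bool) (t : ℕ) (v : ℕ → Bool) : α :=
  (halve (R t) (cell R t v)).2

lemma mem_cell {R : ℕ → α → α → Bool} {t : ℕ} {v : ℕ → Bool} {i : α} :
    i ∈ cell R t v ↔ bits R t i = v := by simp [cell]

open Classical in
lemma bits_succ (R : ℕ → α → α → Bool) (t : ℕ) (i : α) :
    bits R (t + 1) i = Function.update (bits R t i) t
      (decide (i ∈ (halve (R t) (cell R t (bits R t i))).1)) := rfl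

lemma bits_congr {R R' : ℕ → α → α → Bool} (t : ℕ) (h : ∀ s < t, R s = R' s) :
    bits R t = bits R' t := by
  induction t with
  | zero => rfl
  | succ t ih =>
    have h1 := ih fun s hs => h s (by omega)
    ext1 i
    rw [bits_succ, bits_succ, cell, cell, h1, h t (by omega)]

lemma splitter_congr {R R' : ℕ → α → α → Bool} (t : ℕ) (h : ∀ s ≤ t, R s = R' s) (v : ℕ → Bool) :
    splitter R t v = splitter R' t v := by
  rw [splitter, splitter, cell, cell, bits_congr t fun s hs => h s hs.le, h t le_rfl]

lemma bits_of_le (R : ℕ → α → α → Bool) (i : α) (t s : ℕ) (h : t ≤ s) : bits R t i s = false := by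
  induction t with
  | zero => rfl
  | succ t ih => rw [bits_succ, Function.update_of_ne (by omega), ih (by omega)]

lemma bits_of_lt (R : ℕ → α → α → Bool) (i : α) {s t : ℕ} (h : s < t) :
    bits R t i s = bits R (s + 1) i s := by
  induction t with
  | zero => omega
  | succ t ih =>
    rcases Nat.lt_succ_iff_lt_or_eq.1 h with h | rfl
    · rw [bits_succ, Function.update_of_ne (by omega), ih h]
    · rfl

variable {T : ℕ}

/-- The first `t` bits of a path, padded by `false`. -/
def truncatePath (t : ℕ) (y : Fin T → Bool) (s : ℕ) : Bool :=
  if h : s < T then (if s < t then y ⟨s, h⟩ else false) else false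

/-- The path of a sample. -/
noncomputable def samplePath (R : ℕ → α → α → Bool) (T : ℕ) (i : α) (t : Fin T) : Bool :=
  bits R T i t

lemma truncatePath_congr {t : ℕ} {y z : Fin T → Bool} (h : ∀ s : Fin T, s.val < t → y s = z s) :
    truncatePath t y = truncatePath t z := by
  ext s
  unfold truncatePath
  split_ifs with h1 h2
  · rw [h ⟨s, h1⟩ h2]
  · rfl
  · rfl

lemma truncatePath_succ (t : Fin T) (y : Fin T → Bool) :
    truncatePath (t + 1) y = Function.update (truncatePath t y) t (y t) := by
  ext s
  by_cases h : s = t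
  · subst h; simp [truncatePath]
  · have : s < t.val + 1 ↔ s < t.val := by omega
    simp [truncatePath, h, this]

lemma bits_eq_truncatePath (R : ℕ → α → α → Bool) {t : ℕ} (ht : t ≤ T) (i : α) :
    bits R t i = truncatePath t (samplePath R T i) := by
  ext s
  unfold truncatePath samplePath
  split_ifs with h1 h2
  · rw [bits_of_lt R i h2, bits_of_lt R i h1]
  · rw [bits_of_le R i _ _ (by omega)]
  · rw [bits_of_le R i _ _ (by omega)]

lemma truncatePath_injective : Function.Injective (truncatePath T : (Fin T → Bool) → ℕ → Bool) := by
  intro y z h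
  ext t
  simpa [truncatePath] using congrFun h t

lemma samplePath_eq_iff (R : ℕ → α → α → Bool) (i : α) (y : Fin T → Bool) :
    samplePath R T i = y ↔ i ∈ cell R T (truncatePath T y) := by
  rw [mem_cell, bits_eq_truncatePath R le_rfl, truncatePath_injective.eq_iff]

lemma bits_succ_eq_iff (R : ℕ → α → α → Bool) (t : Fin T) (y : Fin T → Bool) (i : α) :
    bits R (t + 1) i = truncatePath (t + 1) y ↔ i ∈ cell R t (truncatePath t y) ∧
      (y t = true ↔ i ∈ (halve (R t) (cell R t (truncatePath t y))).1) := by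
  classical
  rw [mem_cell]
  constructor
  · intro h
    have h1 : bits R t i = truncatePath t y := by
      ext s
      by_cases hs : s = t
      · subst hs; rw [bits_of_le _ _ _ _ le_rfl]; simp [truncatePath]
      · have := congrFun h s
        rwa [bits_succ, truncatePath_succ, Function.update_of_ne hs,
          Function.update_of_ne hs] at this
    refine ⟨h1, ?_⟩
    have := congrFun h t
    rw [bits_succ, truncatePath_succ, Function.update_self, Function.update_self, h1] at this
    rw [← this, decide_eq_true_iff]
  · rintro ⟨h1, h2⟩
    rw [bits_succ, truncatePath_succ, h1]
    congr 1
    rw [Bool.eq_iff_iff, decide_eq_true_iff, h2]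

/-- A halving halves the accumulated deviation and adds at most 1/2 by rounding, so it never exceeds
1. The data are arbitrary: no corruption can unbalance the cells. -/
lemma abs_card_cell_sub_le {R : ℕ → α → α → Bool} {f : ℕ → α → ℝ}
    (hR : ∀ t i j, R t i j = decide (f t i ≤ f t j)) (y : Fin T → Bool) {t : ℕ} (ht : t ≤ T) :
    |((cell R t (truncatePath t y)).card : ℝ) - Fintype.card α / 2 ^ t| ≤ 1 := by
  classical
  induction t with
  | zero =>
    have : cell R 0 (truncatePath 0 y) = Finset.univ := by
      ext i
      simp only [mem_cell, Finset.mem_univ, iff_true]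
      ext s
      simp [bits, truncatePath]
    simp [this]
  | succ t ih =>
    have ih := ih (by omega)
    set c := cell R t (truncatePath t y) with hc
    have hH := isHalving_halve (hR t) c
    have key : |((cell R (t + 1) (truncatePath (t + 1) y)).card : ℝ) - c.card / 2| ≤ 1 / 2 := by
      have hmem : ∀ i, i ∈ cell R (t + 1) (truncatePath (t + 1) y) ↔
          i ∈ c ∧ (y ⟨t, ht⟩ = true ↔ i ∈ (halve (R t) c).1) := fun i => by
        rw [mem_cell]; exact bits_succ_eq_iff R ⟨t, ht⟩ y i
      have hcard := hH.2.1
      cases hy : y ⟨t, ht⟩ with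
      | true =>
        have : cell R (t + 1) (truncatePath (t + 1) y) = (halve (R t) c).1 := by
          ext i
          rw [hmem, hy]
          simpa using fun h => hH.1 h
        rw [this, hcard]
        have h1 : c.card = 2 * (c.card / 2) + c.card % 2 := by omega
        have h2 : c.card % 2 ≤ 1 := by omega
        have h1' : (c.card : ℝ) = 2 * ((c.card / 2 : ℕ) : ℝ) + ((c.card % 2 : ℕ) : ℝ) := by
          exact_mod_cast h1
        have h2' : ((c.card % 2 : ℕ) : ℝ) ≤ 1 := by exact_mod_cast h2
        have h3' : (0 : ℝ) ≤ ((c.card % 2 : ℕ) : ℝ) := by positivity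
        rw [abs_le]; constructor <;> linarith
      | false =>
        have : cell R (t + 1) (truncatePath (t + 1) y) = c \ (halve (R t) c).1 := by
          ext i
          rw [hmem, hy]
          simp
        rw [this, Finset.card_sdiff_of_subset hH.1, hcard]
        have h1 : c.card = 2 * (c.card - c.card / 2) - c.card % 2 := by omega
        have h2 : c.card % 2 ≤ 1 := by omega
        have h1' : (c.card : ℝ) = 2 * ((c.card - c.card / 2 : ℕ) : ℝ) - ((c.card % 2 : ℕ) : ℝ) := by
          rw [eq_sub_iff_add_eq]
          exact_mod_cast (by omega : c.card + c.card % 2 = 2 * (c.card - c.card / 2))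
        have h2' : ((c.card % 2 : ℕ) : ℝ) ≤ 1 := by exact_mod_cast h2
        have h3' : (0 : ℝ) ≤ ((c.card % 2 : ℕ) : ℝ) := by positivity
        rw [abs_le]; constructor <;> linarith
    rw [pow_succ, ← div_div]
    rw [abs_le] at *
    constructor <;> linarith [key.1, key.2, ih.1, ih.2]

/-- Samples tied with the threshold may get either bit; the overlapping half-lines of `binHalfLine`
absorb this. -/
lemma samplePath_spec {R : ℕ → α → α → Bool} {f : ℕ → α → ℝ}
    (hR : ∀ t i j, R t i j = decide (f t i ≤ f t j)) (i : α) (t : Fin T) :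
    (samplePath R T i t = false →
      f t i ≤ f t (splitter R t (truncatePath t (samplePath R T i)))) ∧
    (samplePath R T i t = true →
      f t (splitter R t (truncatePath t (samplePath R T i))) ≤ f t i) := by
  have h1 := (bits_succ_eq_iff R t (samplePath R T i) i).1
    (bits_eq_truncatePath R (T := T) t.isLt i)
  have hH := isHalving_halve (hR t) (cell R t (truncatePath t (samplePath R T i)))
  constructor
  · intro h
    have h2 := hH.2.2.1 i h1.1 (by rw [← h1.2, h]; simp)
    rw [hR] at h2
    exact of_decide_eq_true h2
  · intro h
    have h2 := hH.2.2.2 i (h1.2.1 h)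
    rw [hR] at h2
    exact of_decide_eq_true h2

/-- A sample whose coordinate `t` is a median of those of the separating samples, where the cells
have equal weights. -/
noncomputable def medianSplitter (R : ℕ → α → α → Bool) (t : Fin T) : α :=
  let g : (Fin T → Bool) → α := fun y => splitter R t (truncatePath t y)
  g (halve (fun y z => R t (g y) (g z)) Finset.univ).2

lemma medianSplitter_congr {R R' : ℕ → α → α → Bool} (t : Fin T) (h : ∀ s ≤ t.val, R s = R' s) :
    medianSplitter R t = medianSplitter R' t := by
  simp only [medianSplitter, splitter_congr t h, h t le_rfl]

lemma medianSplitter_spec {R : ℕ → α → α → Bool} {f : ℕ → α → ℝ}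
    (hR : ∀ t i j, R t i j = decide (f t i ≤ f t j)) (t : Fin T) :
    2 ^ T ≤ 2 * (Finset.univ.filter fun y : Fin T → Bool =>
      f t (splitter R t (truncatePath t y)) ≤ f t (medianSplitter R t)).card ∧
    2 ^ T ≤ 2 * (Finset.univ.filter fun y : Fin T → Bool =>
      f t (medianSplitter R t) ≤ f t (splitter R t (truncatePath t y))).card := by
  classical
  set g : (Fin T → Bool) → α := fun y => splitter R t (truncatePath t y) with hg
  have hH := isHalving_halve (R := fun y z => R t (g y) (g z)) (f := fun y => f t (g y))
    (fun y z => hR t _ _) Finset.univ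
  set p := halve (fun y z => R t (g y) (g z)) Finset.univ with hp
  have hcard : (Finset.univ : Finset (Fin T → Bool)).card = 2 ^ T := by simp
  -- The existence of t forces T > 0, so the paths are halved exactly.
  have heven : 2 * (2 ^ T / 2) = 2 ^ T :=
    Nat.mul_div_cancel' (dvd_pow_self 2 (by have := t.isLt; omega))
  have hm : medianSplitter R t = g p.2 := rfl
  have h1 := hH.2.1
  rw [hcard] at h1
  rw [hm]
  constructor
  · have h2 : p.1ᶜ ⊆ Finset.univ.filter fun y : Fin T → Bool => f t (g y) ≤ f t (g p.2) := by
      intro y hy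
      have := hH.2.2.1 y (Finset.mem_univ y) (Finset.mem_compl.1 hy)
      simp only [hR, decide_eq_true_eq] at this
      simpa using this
    have h3 := Finset.card_le_card h2
    have h4 := Finset.card_compl p.1
    rw [h1] at h4
    simp only [Fintype.card_fun, Fintype.card_bool, Fintype.card_fin] at h4
    change 2 ^ T ≤ 2 * (Finset.univ.filter fun y : Fin T → Bool => f t (g y) ≤ f t (g p.2)).card
    omega
  · have h2 : p.1 ⊆ Finset.univ.filter fun y : Fin T → Bool => f t (g p.2) ≤ f t (g y) := by
      intro y hy
      have := hH.2.2.2 y hy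
      simp only [hR, decide_eq_true_eq] at this
      simpa using this
    have h3 := Finset.card_le_card h2
    change 2 ^ T ≤ 2 * (Finset.univ.filter fun y : Fin T → Bool => f t (g p.2) ≤ f t (g y)).card
    omega

end Labels

/-! ### The estimator and its measurability -/

section Estimator

variable {n T : ℕ}

/-- The order patterns of the coordinates seen up to round `t`. -/
noncomputable def orderPattern (t : Fin T) (x : Fin n → Set.Iic t → ℝ) :
    Set.Iic t → Fin n → Fin n → Bool := fun s i j => decide (x i s ≤ x j s)

lemma measurable_orderPattern (t : Fin T) : Measurable (orderPattern (n := n) t) := by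
  refine measurable_pi_lambda _ fun s => measurable_pi_lambda _ fun i =>
    measurable_pi_lambda _ fun j => measurable_to_bool ?_
  have : (fun x : Fin n → Set.Iic t → ℝ => orderPattern t x s i j) ⁻¹' {true} =
      {x | x i s ≤ x j s} := by ext x; simp [orderPattern]
  rw [this]
  exact measurableSet_le (by fun_prop) (by fun_prop)

/-- Extension of a sequence of order patterns by trivial ones. -/
def extendPattern (t : Fin T) (p : Set.Iic t → Fin n → Fin n → Bool) (s : ℕ) :
    Fin n → Fin n → Bool :=
  if h : ∃ hs : s < T, (⟨s, hs⟩ : Fin T) ≤ t then p ⟨⟨s, h.1⟩, h.2⟩ else fun _ _ => false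

/-- The estimator that outputs the median of the medians of all cells. -/
noncomputable def medianEstimator (n T : ℕ) [Nonempty (Fin n)] : OnlineEstimator n T where
  output t x := x (medianSplitter (extendPattern t (orderPattern t x)) t) ⟨t, le_refl t⟩
  measurable_output t := by
    -- The selected index factors through the order patterns, a finite type on which every function
    -- is measurable.
    have h1 : Measurable fun x : Fin n → Set.Iic t → ℝ =>
        medianSplitter (extendPattern t (orderPattern t x)) t :=
      (measurable_of_finite fun p : Set.Iic t → Fin n → Fin n → Bool =>
        medianSplitter (extendPattern t p) t).comp (measurable_orderPattern t)
    have h2 : Measurable fun q : (Fin n → Set.Iic t → ℝ) × Fin n => q.1 q.2 ⟨t, le_refl t⟩ :=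
      measurable_from_prod_countable_left fun i => by fun_prop
    exact h2.comp (measurable_id.prodMk h1)

lemma medianEstimator_spec [Nonempty (Fin n)] (x : Fin n → EuclideanSpace ℝ (Fin T)) :
    ∃ (ℓ : Fin n → Fin T → Bool) (m : Fin T → (Fin T → Bool) → ℝ), PathPredictable m ∧
      (∀ y, |((Finset.univ.filter fun i => ℓ i = y).card : ℝ) - n / 2 ^ T| ≤ 1) ∧
      (∀ i t, ℓ i t = false → x i t ≤ m t (ℓ i)) ∧ (∀ i t, ℓ i t = true → m t (ℓ i) ≤ x i t) ∧
      ∀ t, 2 ^ T ≤ 2 * (Finset.univ.filter fun y =>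
          m t y ≤ (medianEstimator n T).estimate x t).card ∧
        2 ^ T ≤ 2 * (Finset.univ.filter fun y =>
          (medianEstimator n T).estimate x t ≤ m t y).card := by
  classical
  let f : ℕ → Fin n → ℝ := fun s i => if h : s < T then x i ⟨s, h⟩ else 0
  let R : ℕ → Fin n → Fin n → Bool := fun s i j => decide (f s i ≤ f s j)
  have hR : ∀ t i j, R t i j = decide (f t i ≤ f t j) := fun _ _ _ => rfl
  have hf : ∀ (t : Fin T) i, f t i = x i t := fun t i => by simp [f]
  have hest : ∀ t : Fin T, (medianEstimator n T).estimate x t = f t (medianSplitter R t) := by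
    intro t
    rw [hf]
    change x (medianSplitter (α := Fin n) (extendPattern t (orderPattern t fun i s => x i s)) t) t = _
    suffices h : medianSplitter (extendPattern t (orderPattern t fun i s => x i s)) t =
        medianSplitter R t by rw [h]
    refine medianSplitter_congr t fun s hs => ?_
    have hsT : s < T := lt_of_le_of_lt hs t.isLt
    have h : ∃ hs : s < T, (⟨s, hs⟩ : Fin T) ≤ t := ⟨hsT, hs⟩
    simp only [extendPattern, dif_pos h]
    ext i j
    simp [orderPattern, R, f, hsT]
  refine ⟨samplePath R T, fun t y => f t (splitter R t (truncatePath t y)), ?_, ?_, ?_, ?_, ?_⟩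
  · intro t y z h
    beta_reduce
    rw [truncatePath_congr (t := t.val) fun s hs => h s hs]
  · intro y
    have := abs_card_cell_sub_le hR y le_rfl
    rw [Fintype.card_fin] at this
    rw [show (Finset.univ.filter fun i => samplePath R T i = y) = cell R T (truncatePath T y) by
      ext i; simp [samplePath_eq_iff]]
    exact this
  · intro i t h
    rw [← hf]
    exact (samplePath_spec hR i t).1 h
  · intro i t h
    rw [← hf]
    exact (samplePath_spec hR i t).2 h
  · intro t
    simp only [hest]
    exact medianSplitter_spec hR t

end Estimator

/-! ### Quantile bins of an atomless law -/

section Quantile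

variable (γ : Measure ℝ) (G : ℕ)

/-- The index of the quantile bin of `x`, when the distribution `γ` is cut into `G` bins. -/
noncomputable def quantileBin (x : ℝ) : ℕ := ⌊G * cdf γ x⌋₊

lemma monotone_quantileBin : Monotone (quantileBin γ G) := fun _ _ h =>
  Nat.floor_mono (mul_le_mul_of_nonneg_left (monotone_cdf γ h) (Nat.cast_nonneg G))

lemma quantileBin_lt (x : ℝ) : quantileBin γ G x < G + 1 := by
  refine Nat.lt_succ_of_le (Nat.floor_le_of_le ?_)
  exact mul_le_of_le_one_right (Nat.cast_nonneg G) (cdf_le_one γ x)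

lemma measurable_quantileBin : Measurable (quantileBin γ G) := (monotone_quantileBin γ G).measurable

/-- On a bin, G times the cdf stays in [j, j + 1), so an interval with endpoints in the bin has mass
at most 1/G. Inner regularity reduces the bin to a compact subset, which lies between its own least
and greatest points. -/
lemma measureReal_quantileBin_eq_le [IsProbabilityMeasure γ] [NullSingletonClass γ] (hG : 0 < G) (j : ℕ) :
    γ.real {x | quantileBin γ G x = j} ≤ 1 / G := by
  have hG' : (0 : ℝ) < G := by exact_mod_cast hG
  by_contra h
  push Not at h
  have hS : MeasurableSet {x | quantileBin γ G x = j} :=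
    measurable_quantileBin γ G (measurableSet_singleton j)
  have h' : ENNReal.ofReal (1 / G) < γ {x | quantileBin γ G x = j} := by
    rwa [ENNReal.ofReal_lt_iff_lt_toReal (by positivity) (measure_ne_top _ _)]
  obtain ⟨K, hKS, hK, hlt⟩ := hS.exists_lt_isCompact h'
  have hne : K.Nonempty := by
    rw [Set.nonempty_iff_ne_empty]
    rintro rfl
    simp at hlt
  obtain ⟨a, haK, ha⟩ := hK.exists_isLeast hne
  obtain ⟨b, hbK, hb⟩ := hK.exists_isGreatest hne
  have hKab : K ⊆ Set.Icc a b := fun x hx => ⟨ha hx, hb hx⟩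
  have h1 : γ K ≤ ENNReal.ofReal (1 / G) := by
    refine (measure_mono hKab).trans ?_
    rw [← Ioc_ae_eq_Icc.measure_eq]
    nth_rewrite 1 [← measure_cdf γ]
    rw [StieltjesFunction.measure_Ioc]
    refine ENNReal.ofReal_le_ofReal ?_
    have ha' : (j : ℝ) ≤ G * cdf γ a := by
      have : quantileBin γ G a = j := hKS haK
      rw [← this]
      exact Nat.floor_le (mul_nonneg hG'.le (cdf_nonneg γ a))
    have hb' : G * cdf γ b < j + 1 := by
      have : quantileBin γ G b = j := hKS hbK
      rw [← this]
      exact Nat.lt_floor_add_one _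
    rw [le_div_iff₀ hG']
    linarith
  exact absurd hlt (not_lt.2 h1)

end Quantile

/-! ### Concentration of empirical frequencies -/

section Hoeffding

variable {E : Type*} [MeasurableSpace E]

open Classical in
/-- **Hoeffding's inequality** for the empirical frequency of an event. -/
lemma measure_pi_card_ge_le (P : Measure E) [IsProbabilityMeasure P] (n : ℕ) {W : Set E}
    (hW : MeasurableSet W) {ε : ℝ} (hε : 0 ≤ ε) :
    (Measure.pi fun _ : Fin n => P).real
      {c | n * (P.real W + ε) ≤ (Finset.univ.filter fun i => c i ∈ W).card} ≤
        Real.exp (-2 * n * ε ^ 2) := by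
  let X : E → ℝ := W.indicator 1
  have hXm : Measurable X := measurable_one.indicator hW
  have hX01 : ∀ x, X x ∈ Set.Icc (0 : ℝ) 1 := fun x => by
    by_cases hx : x ∈ W <;> simp [X, hx]
  have hXint : ∫ x, X x ∂P = P.real W := integral_indicator_one hW
  have hsub := hasSubgaussianMGF_of_mem_Icc (μ := P) hXm.aemeasurable (.of_forall hX01)
  rw [hXint] at hsub
  have hind : iIndepFun (fun (i : Fin n) (c : Fin n → E) => X (c i) - P.real W)
      (Measure.pi fun _ => P) :=
    iIndepFun_pi (X := fun (_ : Fin n) x => X x - P.real W)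
      (fun _ => (hXm.sub_const _).aemeasurable)
  have hsub' : ∀ i ∈ (Finset.univ : Finset (Fin n)),
      HasSubgaussianMGF (fun c : Fin n → E => X (c i) - P.real W) ((‖(1 : ℝ) - 0‖₊ / 2) ^ 2)
        (Measure.pi fun _ => P) := by
    intro i _
    refine HasSubgaussianMGF.of_map (Y := fun c : Fin n → E => c i) (X := fun x => X x - P.real W)
      (measurable_pi_apply i).aemeasurable ?_
    rw [(measurePreserving_eval (fun _ : Fin n => P) i).map_eq]
    exact hsub
  have h := HasSubgaussianMGF.measure_sum_ge_le_of_iIndepFun hind hsub' (ε := n * ε) (by positivity)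
  have hset : {c : Fin n → E | n * (P.real W + ε) ≤ (Finset.univ.filter fun i => c i ∈ W).card} =
      {c | n * ε ≤ ∑ i, (X (c i) - P.real W)} := by
    ext c
    have : ∑ i, (X (c i) - P.real W) = (Finset.univ.filter fun i => c i ∈ W).card - n * P.real W := by
      simp [X, Set.indicator_apply, Finset.sum_boole]
    simp only [Set.mem_ofPred_eq, this]
    constructor <;> intro h <;> linarith
  rw [hset]
  refine h.trans (le_of_eq ?_)
  congr 1
  rcases Nat.eq_zero_or_pos n with rfl | hn
  · simp
  · have : (n : ℝ) ≠ 0 := by positivity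
    simp
    field_simp

end Hoeffding

/-! ### Gaussian product sets and a density bound -/

section GaussianBox

lemma multivariateGaussian_one_eq_map {ι : Type*} [Fintype ι] [DecidableEq ι]
    (μ : EuclideanSpace ℝ ι) : multivariateGaussian μ 1 =
      (Measure.pi fun _ : ι => gaussianReal 0 1).map fun u => μ + WithLp.toLp 2 u := by
  rw [multivariateGaussian, ← map_pi_eq_stdGaussian, Measure.map_map (by fun_prop) (by fun_prop)]
  congr 1
  ext1 u
  simp

lemma multivariateGaussian_one_real_box {ι : Type*} [Fintype ι] [DecidableEq ι]
    (μ : EuclideanSpace ℝ ι) {S : ι → Set ℝ} (hS : ∀ t, MeasurableSet (S t)) :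
    (multivariateGaussian μ 1).real {x | ∀ t, x t - μ t ∈ S t} =
      ∏ t, (gaussianReal 0 1).real (S t) := by
  have hm : MeasurableSet {x : EuclideanSpace ℝ ι | ∀ t, x t - μ t ∈ S t} := by
    simp only [Set.ofPred_forall]
    exact MeasurableSet.iInter fun t =>
      (show Measurable fun x : EuclideanSpace ℝ ι => x t - μ t by fun_prop) (hS t)
  rw [multivariateGaussian_one_eq_map, map_measureReal_apply (by fun_prop) hm]
  have : (fun u : ι → ℝ => μ + WithLp.toLp 2 u) ⁻¹' {x | ∀ t, x t - μ t ∈ S t} =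
      Set.univ.pi S := by
    ext u; simp [Set.mem_pi]
  rw [this, measureReal_def, Measure.pi_pi, ENNReal.toReal_prod]
  rfl

/-- On [-1, 1] the density is at least 1/√(2πe) > 1/5. -/
lemma le_gaussianReal_Ioc {a b : ℝ} (ha : -1 ≤ a) (hb : b ≤ 1) :
    (b - a) / 5 ≤ (gaussianReal 0 1).real (Set.Ioc a b) := by
  have hpdf : ∀ x ∈ Set.Ioc a b, ENNReal.ofReal (1 / 5) ≤ gaussianPDF 0 1 x := by
    intro x hx
    refine ENNReal.ofReal_le_ofReal ?_
    have hx1 : x ^ 2 ≤ 1 := by nlinarith [hx.1, hx.2]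
    rw [gaussianPDFReal]
    simp only [NNReal.coe_one, mul_one, sub_zero]
    have h1 : Real.exp (-(1 / 2)) ≤ Real.exp (-x ^ 2 / 2) := Real.exp_le_exp.2 (by linarith)
    refine le_trans ?_ (mul_le_mul_of_nonneg_left h1 (by positivity))
    rw [Real.exp_neg, ← mul_inv, one_div]
    refine inv_anti₀ (by positivity) (le_of_sq_le_sq ?_ (by norm_num))
    rw [mul_pow, Real.sq_sqrt (by positivity), ← Real.exp_nat_mul]
    have h2 := Real.exp_one_lt_d9
    have h3 := Real.pi_lt_d2
    have h4 := Real.pi_pos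
    rw [show ((2 : ℕ) : ℝ) * (1 / 2) = 1 by norm_num]
    nlinarith [Real.exp_pos 1]
  have h : ENNReal.ofReal ((b - a) / 5) ≤ gaussianReal 0 1 (Set.Ioc a b) := by
    rw [gaussianReal_apply _ one_ne_zero]
    refine le_trans (le_of_eq ?_) (setLIntegral_mono' measurableSet_Ioc hpdf)
    rw [setLIntegral_const, Real.volume_Ioc, ← ENNReal.ofReal_mul (by norm_num)]
    congr 1
    ring
  exact (ENNReal.ofReal_le_iff_le_toReal (measure_ne_top _ _)).1 h

end GaussianBox

/-! ### Uniform concentration over binned trees -/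

section TreeEvents

variable {T : ℕ}

/-- The points at or above (for `true`), or at or below (for `false`), the `j`-th quantile bin. -/
def binHalfLine (γ : Measure ℝ) (G j : ℕ) (b : Bool) : Set ℝ :=
  {u | if b then j ≤ quantileBin γ G u else quantileBin γ G u ≤ j}

lemma measurableSet_binHalfLine (γ : Measure ℝ) (G j : ℕ) (b : Bool) :
    MeasurableSet (binHalfLine γ G j b) := by
  cases b
  · exact measurable_quantileBin γ G measurableSet_Iic
  · exact measurable_quantileBin γ G measurableSet_Ici

/-- The half-lines overlap exactly in bin j; this excess is the price of having finitely many trees.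
-/
lemma measureReal_binHalfLine_add_le (γ : Measure ℝ) [IsProbabilityMeasure γ]
    [NullSingletonClass γ] {G : ℕ} (hG : 0 < G) (j : ℕ) (b : Bool) :
    γ.real (binHalfLine γ G j b) + γ.real (binHalfLine γ G j (!b)) ≤ 1 + 1 / G := by
  have hu : binHalfLine γ G j b ∩ binHalfLine γ G j (!b) ⊆ {x | quantileBin γ G x = j} := by
    rintro x ⟨h1, h2⟩
    cases b
    · exact le_antisymm h1 h2
    · exact le_antisymm h2 h1
  rw [← measureReal_union_add_inter (measurableSet_binHalfLine γ G j _)]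
  exact add_le_add measureReal_le_one
    ((measureReal_mono hu).trans (measureReal_quantileBin_eq_le γ G hG j))

/-- The points whose centered coordinates can follow some path in `A` of the tree with the binned
thresholds `g`. -/
def treeEvent (μ : EuclideanSpace ℝ (Fin T)) (G : ℕ) (g : Fin T → (Fin T → Bool) → ℕ)
    (A : Finset (Fin T → Bool)) : Set (EuclideanSpace ℝ (Fin T)) :=
  ⋃ y ∈ A, {x | ∀ t, x t - μ t ∈ binHalfLine (gaussianReal 0 1) G (g t y) (y t)}

lemma measurableSet_treeEvent (μ : EuclideanSpace ℝ (Fin T)) (G : ℕ)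
    (g : Fin T → (Fin T → Bool) → ℕ) (A : Finset (Fin T → Bool)) :
    MeasurableSet (treeEvent μ G g A) := by
  refine Finset.measurableSet_biUnion _ fun y _ => ?_
  simp only [Set.ofPred_forall]
  exact MeasurableSet.iInter fun t =>
    (show Measurable fun x : EuclideanSpace ℝ (Fin T) => x t - μ t by fun_prop)
      (measurableSet_binHalfLine _ _ _ _)

lemma measureReal_treeEvent_le (μ : EuclideanSpace ℝ (Fin T)) (G : ℕ)
    (g : Fin T → (Fin T → Bool) → ℕ) (A : Finset (Fin T → Bool)) :
    (multivariateGaussian μ 1).real (treeEvent μ G g A) ≤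
      ∑ y ∈ A, ∏ t, (gaussianReal 0 1).real (binHalfLine (gaussianReal 0 1) G (g t y) (y t)) := by
  refine (measureReal_biUnion_finset_le _ _).trans (le_of_eq (Finset.sum_congr rfl fun y _ => ?_))
  exact multivariateGaussian_one_real_box μ fun t => measurableSet_binHalfLine _ _ _ _

open Classical in
/-- The event that some tree event has too many of the samples `c`. -/
def deviationEvent (μ : EuclideanSpace ℝ (Fin T)) (G n : ℕ) (ε : ℝ) :
    Set (Fin n → EuclideanSpace ℝ (Fin T)) :=
  ⋃ p : (Fin T → (Fin T → Bool) → Fin (G + 1)) × Finset (Fin T → Bool),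
    {c | n * ((multivariateGaussian μ 1).real (treeEvent μ G (fun t y => p.1 t y) p.2) + ε) ≤
      (Finset.univ.filter fun i => c i ∈ treeEvent μ G (fun t y => p.1 t y) p.2).card}

lemma measureReal_deviationEvent_le (μ : EuclideanSpace ℝ (Fin T)) (G n : ℕ) {ε : ℝ} (hε : 0 ≤ ε) :
    (Measure.pi fun _ : Fin n => multivariateGaussian μ 1).real (deviationEvent μ G n ε) ≤
      ((G + 1) ^ (2 ^ T * T) * 2 ^ 2 ^ T) * Real.exp (-2 * n * ε ^ 2) := by
  refine (measureReal_iUnion_fintype_le _).trans ?_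
  refine (Finset.sum_le_card_nsmul _ _ _ fun p _ => measure_pi_card_ge_le
    (multivariateGaussian μ 1) n (measurableSet_treeEvent μ G _ p.2) hε).trans (le_of_eq ?_)
  rw [nsmul_eq_mul]
  congr 1
  simp [pow_mul]

/-- With the crude bound log(G + 1) ≤ G ≤ 3T/ε, the logarithm of the number of events is at most 4 ·
2^T · T²/ε, which the Hoeffding exponent 2nε² outweighs. -/
lemma card_mul_exp_le {T n G : ℕ} {ε τ : ℝ} (hT : 0 < T) (hε : 0 < ε) (hε1 : ε ≤ 1)
    (hτ : 0 < τ) (hτ1 : τ < 1) (hG : (G : ℝ) ≤ 3 * T / ε)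
    (hn : (2 : ℝ) ^ T * (5 * (T / ε) ^ 3) * Real.log (2 / τ) ≤ n) :
    ((G + 1) ^ (2 ^ T * T) * 2 ^ 2 ^ T) * Real.exp (-2 * n * ε ^ 2) ≤ τ := by
  have hT1 : (1 : ℝ) ≤ T := by exact_mod_cast hT
  set l := Real.log (2 / τ) with hl
  have hlog : l = Real.log 2 - Real.log τ := Real.log_div two_ne_zero hτ.ne'
  have hlτ : Real.log τ < 0 := Real.log_neg hτ hτ1
  have hl2 := Real.log_two_gt_d9
  have hl3 := Real.log_two_lt_d9
  have hl1 : 1 / 2 ≤ l := by linarith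
  have hG1 : Real.log (G + 1) ≤ G := by
    have := Real.log_le_sub_one_of_pos (show (0 : ℝ) < G + 1 by positivity)
    linarith
  have hpos : (0 : ℝ) < (G + 1) ^ (2 ^ T * T) * 2 ^ 2 ^ T := by positivity
  rw [← Real.log_le_log_iff (by positivity) hτ, Real.log_mul hpos.ne' (Real.exp_ne_zero _),
    Real.log_mul (by positivity) (by positivity), Real.log_pow, Real.log_pow, Real.log_exp]
  push_cast
  set N : ℝ := 2 ^ T with hN
  have hN1 : 1 ≤ N := one_le_pow₀ (by norm_num)
  set w := T ^ 2 / ε with hw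
  have hw1 : 1 ≤ w := by
    rw [hw, le_div_iff₀ hε]
    nlinarith
  have h1 : N * T * Real.log (G + 1) ≤ N * (3 * w) := by
    rw [mul_assoc]
    refine mul_le_mul_of_nonneg_left ?_ (by positivity)
    calc T * Real.log (G + 1) ≤ T * (3 * T / ε) := by gcongr; exact hG1.trans hG
      _ = 3 * w := by rw [hw]; ring
  have h2 : N * Real.log 2 ≤ N * w := by
    refine mul_le_mul_of_nonneg_left ?_ (by positivity)
    linarith
  have h3 : N * (10 * w) * l ≤ 2 * n * ε ^ 2 := by
    calc N * (10 * w) * l ≤ N * (10 * (w * T)) * l := by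
          gcongr
          exact le_mul_of_one_le_right (by positivity) hT1
      _ = 2 * (N * (5 * (T / ε) ^ 3) * l) * ε ^ 2 := by rw [hw]; field_simp; ring
      _ ≤ 2 * n * ε ^ 2 := by gcongr
  -- Of the 10w in `h3`, 8w pays for the union bound, since l ≥ 1/2, and 2w for log(1/τ).
  have h4 : N * (4 * w) ≤ N * (8 * w) * l := by
    have : 0 ≤ N * w := by positivity
    nlinarith
  have h5 : l ≤ N * (2 * w) * l := by
    refine le_mul_of_one_le_left (by linarith) ?_
    nlinarith
  have h6 : -Real.log τ ≤ l := by linarith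
  nlinarith

end TreeEvents

/-! ### Error bound on typical samples -/

section Deterministic

variable {T : ℕ}

/-- If every set of paths has about its uniform mass in a tree of binned thresholds, then the
biased bits of that tree are close to uniform in total variation. -/
lemma sum_abs_biasDensity_sub_one_le (γ : Measure ℝ) [IsProbabilityMeasure γ]
    [NullSingletonClass γ] {G : ℕ} (hG : 0 < G) {ε : ℝ} (hGε : (1 + 1 / (G : ℝ)) ^ T ≤ 1 + ε)
    {u : Fin T → (Fin T → Bool) → ℝ} (hu : PathPredictable u)
    (h : ∀ A : Finset (Fin T → Bool), (A.card : ℝ) ≤ 2 ^ T *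
      (∑ y ∈ A, ∏ t, γ.real (binHalfLine γ G (quantileBin γ G (u t y)) (y t)) + 3 * ε)) :
    ∑ y, |biasDensity (fun t y => 1 / 2 - cdf γ (u t y)) T y - 1| ≤ 2 ^ T * (8 * ε) := by
  classical
  set b : Fin T → (Fin T → Bool) → ℝ := fun t y => 1 / 2 - cdf γ (u t y) with hb
  set p : Fin T → (Fin T → Bool) → ℝ := fun t y => 1 / 2 + b t y * bitSign (y t) with hp
  set q : Fin T → (Fin T → Bool) → ℝ := fun t y =>
    γ.real (binHalfLine γ G (quantileBin γ G (u t y)) (y t)) with hq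
  have hpred : ∀ t y z, (∀ s ≤ t, y s = z s) → u t y = u t z ∧ y t = z t := fun t y z h =>
    ⟨hu t y z fun s hs => h s hs.le, h t le_rfl⟩
  have hpA : PathAdapted p := fun t y z h => by simp only [hp, hb, (hpred t y z h).1, (hpred t y z h).2]
  have hqA : PathAdapted q := fun t y z h => by simp only [hq, (hpred t y z h).1, (hpred t y z h).2]
  have hp0 : ∀ t y, 0 ≤ p t y := by
    intro t y
    have h0 := cdf_nonneg γ (u t y)
    have h1 := cdf_le_one γ (u t y)
    simp only [hp, hb, bitSign]
    split_ifs <;> linarith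
  -- The half-line cut at the exact threshold lies in the binned one.
  have hpq : ∀ t y, p t y ≤ q t y := by
    intro t y
    simp only [hp, hb, hq]
    cases hy : y t
    · have : Set.Iic (u t y) ⊆ binHalfLine γ G (quantileBin γ G (u t y)) false :=
        fun x hx => monotone_quantileBin γ G hx
      have := measureReal_mono (μ := γ) this
      rw [← cdf_eq_real] at this
      simp only [bitSign, Bool.false_eq_true, if_false]
      linarith
    · have : (Set.Iic (u t y))ᶜ ⊆ binHalfLine γ G (quantileBin γ G (u t y)) true := by
        intro x hx
        exact monotone_quantileBin γ G (le_of_not_ge hx)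
      have := measureReal_mono (μ := γ) this
      rw [probReal_compl_eq_one_sub measurableSet_Iic, ← cdf_eq_real] at this
      simp only [bitSign, if_true]
      linarith
  have hp1 : ∑ y, ∏ t, p t y = 1 := by
    refine sum_prod_eq_one hpA fun t y => ?_
    simp only [hp, hb, flipBit_self, hu.flipBit, bitSign_not]
    ring
  have hq1 : ∑ y, ∏ t, q t y ≤ 1 + ε := by
    refine (sum_prod_le hqA (fun _ _ => measureReal_nonneg) (c := 1 + 1 / G) fun t y => ?_).trans hGε
    simp only [hq, flipBit_self, hu.flipBit]
    exact measureReal_binHalfLine_add_le γ hG _ _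
  have hD : ∀ y, biasDensity b T y = 2 ^ T * ∏ t, p t y := by
    intro y
    rw [biasDensity, prefixProd_all]
    calc ∏ t, (1 + 2 * (b t y * bitSign (y t))) = ∏ t, 2 * p t y :=
          Finset.prod_congr rfl fun t _ => by simp only [hp]; ring
      _ = _ := by rw [Finset.prod_mul_distrib]; simp
  have hle : ∀ y, ∏ t, p t y ≤ ∏ t, q t y := fun y =>
    Finset.prod_le_prod (fun t _ => hp0 t y) fun t _ => hpq t y
  -- As p ≤ q with totals 1 and at most 1 + ε, binning adds at most ε to any set. One-sided bounds
  -- suffice: the density has mean 1, so its L1 distance to 1 is twice its deficit.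
  have hA : ∀ A : Finset (Fin T → Bool), ∑ y ∈ A, (1 - biasDensity b T y) ≤ 2 ^ T * (4 * ε) := by
    intro A
    have h1 : ∑ y ∈ A, ∏ t, q t y ≤ ∑ y ∈ A, ∏ t, p t y + ε := by
      have h2 := Finset.sum_le_sum_of_subset_of_nonneg (Finset.subset_univ A)
        (f := fun y => ∏ t, q t y - ∏ t, p t y) fun y _ _ => sub_nonneg.2 (hle y)
      rw [Finset.sum_sub_distrib, Finset.sum_sub_distrib, hp1] at h2
      linarith
    have h3 := h A
    have h4 : (0 : ℝ) < 2 ^ T := by positivity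
    simp only [Finset.sum_sub_distrib, hD, ← Finset.mul_sum, Finset.sum_const, nsmul_eq_mul, mul_one]
    nlinarith
  have h0 : ∑ y, (1 - biasDensity b T y) = 0 := by
    simp only [Finset.sum_sub_distrib, hD, ← Finset.mul_sum, hp1]
    simp
  calc ∑ y, |biasDensity b T y - 1|
      = ∑ y, (2 * (if biasDensity b T y < 1 then 1 - biasDensity b T y else 0) -
          (1 - biasDensity b T y)) := by
        refine Finset.sum_congr rfl fun y _ => ?_
        split_ifs with hy
        · rw [abs_of_neg (by linarith)]; ring
        · rw [abs_of_nonneg (by linarith)]; ring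
    _ = 2 * ∑ y ∈ Finset.univ.filter fun y => biasDensity b T y < 1, (1 - biasDensity b T y) := by
        rw [Finset.sum_sub_distrib, h0, sub_zero, ← Finset.mul_sum, Finset.sum_filter]
    _ ≤ 2 ^ T * (8 * ε) := by linarith [hA (Finset.univ.filter fun y => biasDensity b T y < 1)]

lemma cdf_gaussianReal_zero : cdf (gaussianReal 0 1) 0 = 1 / 2 := by
  have h1 : (gaussianReal 0 1).real (Set.Ioi 0) = (gaussianReal 0 1).real (Set.Iic 0) := by
    have h2 : (gaussianReal 0 1).map (fun x => -x) = gaussianReal 0 1 := by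
      rw [gaussianReal_map_neg, neg_zero]
    nth_rewrite 2 [← h2]
    rw [map_measureReal_apply measurable_neg measurableSet_Iic,
      show (fun x : ℝ => -x) ⁻¹' Set.Iic 0 = Set.Ici 0 by ext; simp]
    have := nullSingletonClass_gaussianReal (μ := 0) (v := 1) one_ne_zero
    exact measureReal_congr Ioi_ae_eq_Ici
  rw [← Set.compl_Iic, probReal_compl_eq_one_sub measurableSet_Iic, ← cdf_eq_real] at h1
  linarith

lemma cdf_sub_cdf (γ : Measure ℝ) [IsProbabilityMeasure γ] {a b : ℝ} (h : a ≤ b) :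
    cdf γ b - cdf γ a = γ.real (Set.Ioc a b) := by
  rw [cdf_eq_real, cdf_eq_real, ← measureReal_sdiff (Set.Iic_subset_Iic.2 h) measurableSet_Iic]
  congr 1
  ext x
  simp [and_comm]

lemma min_abs_le_abs_cdf_sub (x : ℝ) :
    min |x| 1 ≤ 5 * |cdf (gaussianReal 0 1) x - 1 / 2| := by
  have hm := monotone_cdf (gaussianReal 0 1)
  rw [← cdf_gaussianReal_zero]
  rcases le_total 0 x with hx | hx
  · have h1 := le_gaussianReal_Ioc (a := 0) (b := min x 1) (by norm_num)
      (min_le_right _ _)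
    rw [← cdf_sub_cdf _ (le_min hx zero_le_one)] at h1
    have h2 := hm (min_le_left x 1)
    rw [abs_of_nonneg hx, abs_of_nonneg (sub_nonneg.2 (hm hx))]
    linarith
  · have h0 : max x (-1) ≤ 0 := max_le hx (by norm_num)
    have h1 := le_gaussianReal_Ioc (a := max x (-1)) (b := 0) (le_max_right _ _) zero_le_one
    rw [← cdf_sub_cdf _ h0] at h1
    have h2 := hm (le_max_left x (-1))
    have h3 : min |x| 1 = -max x (-1) := by
      rw [abs_of_nonpos hx]
      rcases le_total x (-1) with h | h
      · rw [max_eq_right h, min_eq_right (by linarith)]; norm_num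
      · rw [max_eq_left h, min_eq_left (by linarith)]
    rw [h3, abs_of_nonpos (sub_nonpos.2 (hm hx))]
    linarith

open Classical in
/-- On typical clean samples, the error of the estimator is small for every corruption. -/
lemma norm_medianEstimator_sub_le {n G : ℕ} [Nonempty (Fin n)] {ε : ℝ} (hε : 0 < ε)
    (hε1 : ε ≤ 1 / 1000) (hG : 0 < G) (hGε : (1 + 1 / (G : ℝ)) ^ T ≤ 1 + ε)
    (hn : (2 : ℝ) ^ T ≤ ε * n) {μ : EuclideanSpace ℝ (Fin T)}
    {c x : Fin n → EuclideanSpace ℝ (Fin T)} (hc : c ∉ deviationEvent μ G n ε)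
    (hx : IsCorruption ε c x) :
    ‖(medianEstimator n T).estimate x - μ‖ ≤ 720 * ε := by
  obtain ⟨ℓ, m, hm, hbal, hlo, hhi, hmed⟩ := medianEstimator_spec x
  obtain ⟨σ, hσ⟩ := hx
  set e := (medianEstimator n T).estimate x with he
  set γ := gaussianReal 0 1 with hγ
  have : NullSingletonClass γ := nullSingletonClass_gaussianReal one_ne_zero
  have hn0 : (0 : ℝ) < n := by
    have : (0 : ℝ) < 2 ^ T := by positivity
    by_contra hcon
    nlinarith
  set u : Fin T → (Fin T → Bool) → ℝ := fun t y => m t y - μ t with hu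
  have hup : PathPredictable u := fun t y z h => by simp only [hu, hm t y z h]
  -- The three errors ε come from the replaced samples, the deviation of the clean ones, and the
  -- rounding of cell sizes, which costs at most 2^T ≤ εn samples.
  have hcount : ∀ A : Finset (Fin T → Bool), (A.card : ℝ) ≤ 2 ^ T *
      (∑ y ∈ A, ∏ t, γ.real (binHalfLine γ G (quantileBin γ G (u t y)) (y t)) + 3 * ε) := by
    intro A
    let g : Fin T → (Fin T → Bool) → Fin (G + 1) := fun t y =>
      ⟨quantileBin γ G (u t y), quantileBin_lt γ G _⟩
    set W := treeEvent μ G (fun t y => g t y) A with hW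
    have h1 : ((Finset.univ.filter fun i => c i ∈ W).card : ℝ) <
        n * ((multivariateGaussian μ 1).real W + ε) := by
      by_contra hcon
      exact hc (Set.mem_iUnion.2 ⟨(g, A), not_lt.1 hcon⟩)
    have h2 := measureReal_treeEvent_le μ G (fun t y => g t y) A
    have h3 : (Finset.univ.filter fun i => ℓ i ∈ A) ⊆ (Finset.univ.filter fun i => x i ≠ c (σ i)) ∪
        (Finset.univ.filter fun i => c (σ i) ∈ W) := by
      intro i hi
      simp only [Finset.mem_union, Finset.mem_filter, Finset.mem_univ, true_and] at hi ⊢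
      by_cases hxi : x i = c (σ i)
      · right
        rw [← hxi]
        refine Set.mem_biUnion hi fun t => ?_
        cases ht : ℓ i t
        · exact monotone_quantileBin γ G (sub_le_sub_right (hlo i t ht) _)
        · exact monotone_quantileBin γ G (sub_le_sub_right (hhi i t ht) _)
      · exact Or.inl hxi
    have h4 : (Finset.univ.filter fun i => c (σ i) ∈ W).card =
        (Finset.univ.filter fun i => c i ∈ W).card :=
      Finset.card_bij (fun i _ => σ i) (by simp) (fun _ _ _ _ h => σ.injective h)
        fun j hj => ⟨σ.symm j, by simpa using hj, by simp⟩
    have h5 : ((Finset.univ.filter fun i => ℓ i ∈ A).card : ℝ) ≤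
        (Finset.univ.filter fun i => x i ≠ c (σ i)).card +
          (Finset.univ.filter fun i => c i ∈ W).card := by
      rw [← h4]
      exact_mod_cast (Finset.card_le_card h3).trans (Finset.card_union_le _ _)
    have h6 : ((Finset.univ.filter fun i => x i ≠ c (σ i)).card : ℝ) ≤ ε * n := by
      rw [Set.ncard_eq_toFinset_card'] at hσ
      simpa using hσ
    have h7 : A.card * ((n : ℝ) / 2 ^ T - 1) ≤ (Finset.univ.filter fun i => ℓ i ∈ A).card := by
      rw [Finset.card_eq_sum_card_fiberwise (f := ℓ) (t := A) (fun i hi => by simpa using hi),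
        ← nsmul_eq_mul]
      push_cast
      refine Finset.card_nsmul_le_sum _ _ _ fun y hy => ?_
      have h8 := (abs_le.1 (hbal y)).1
      have h9 : (Finset.univ.filter fun i => ℓ i ∈ A).filter (fun i => ℓ i = y) =
          Finset.univ.filter fun i => ℓ i = y := by
        ext i
        simp only [Finset.mem_filter, Finset.mem_univ, true_and, and_iff_right_iff_imp]
        rintro rfl
        exact hy
      rw [h9]
      linarith
    have h10 : (A.card : ℝ) ≤ 2 ^ T := by
      have := Finset.card_le_univ A
      rw [Fintype.card_fun, Fintype.card_bool, Fintype.card_fin] at this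
      exact_mod_cast this
    set q := ∑ y ∈ A, ∏ t, γ.real (binHalfLine γ G (quantileBin γ G (u t y)) (y t)) with hq
    have h11 : A.card * ((n : ℝ) / 2 ^ T) ≤ n * (q + 3 * ε) := by
      have : (n : ℝ) * (multivariateGaussian μ 1).real W ≤ n * q :=
        mul_le_mul_of_nonneg_left h2 hn0.le
      nlinarith
    have h12 : (0 : ℝ) < 2 ^ T := by positivity
    rw [mul_div_assoc', div_le_iff₀ h12] at h11
    nlinarith
  have hD := sum_abs_biasDensity_sub_one_le γ hG hGε hup hcount
  set β : Fin T → ℝ := fun t => |cdf γ (e t - μ t) - 1 / 2| with hβ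
  -- At least half of the thresholds lie at or beyond the median e t as seen from μ t, and
  -- monotonicity of the cdf makes their biases at least β t.
  have hβb : ∀ t, (2 : ℝ) ^ T ≤
      2 * (Finset.univ.filter fun y => β t ≤ |1 / 2 - cdf γ (u t y)|).card := by
    intro t
    have hmono := monotone_cdf γ
    have hhalf := cdf_gaussianReal_zero
    rw [← hγ] at hhalf
    rcases le_total 0 (e t - μ t) with h | h
    · refine le_trans (by exact_mod_cast (hmed t).2) (mul_le_mul_of_nonneg_left
        (Nat.cast_le.2 (Finset.card_le_card ?_)) zero_le_two)
      intro y hy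
      simp only [Finset.mem_filter, Finset.mem_univ, true_and] at hy ⊢
      have h1 := hmono h
      have h2 := hmono (sub_le_sub_right hy (μ t))
      rw [hhalf] at h1
      simp only [hβ, hu]
      rw [abs_of_nonneg (by linarith), abs_of_nonpos (by linarith)]
      linarith
    · refine le_trans (by exact_mod_cast (hmed t).1) (mul_le_mul_of_nonneg_left
        (Nat.cast_le.2 (Finset.card_le_card ?_)) zero_le_two)
      intro y hy
      simp only [Finset.mem_filter, Finset.mem_univ, true_and] at hy ⊢
      have h1 := hmono h
      have h2 := hmono (sub_le_sub_right hy (μ t))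
      rw [hhalf] at h1
      simp only [hβ, hu]
      rw [abs_of_nonpos (by linarith), abs_of_nonneg (by linarith)]
      linarith
  have hβ2 : ∑ t, β t ^ 2 ≤ 320 * (8 * ε) ^ 2 := by
    refine sum_sq_le_of_bias (b := fun t y => 1 / 2 - cdf γ (u t y)) ?_ (by positivity)
      (by linarith) hD (fun t => abs_nonneg _) hβb
    intro t y z h
    simp only [hup t y z h]
  -- The smallness of ε gives β t < 1/5, so the cap 1 in `min_abs_le_abs_cdf_sub` is inactive.
  have hcoord : ∀ t, (e t - μ t) ^ 2 ≤ 25 * β t ^ 2 := by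
    intro t
    have h1 := (Finset.single_le_sum (f := fun t => β t ^ 2) (fun s _ => sq_nonneg _)
      (Finset.mem_univ t)).trans hβ2
    have h2 : 0 ≤ β t := abs_nonneg _
    have h3 : β t < 1 / 5 := by
      by_contra hcon
      push Not at hcon
      nlinarith
    have h4 : min |e t - μ t| 1 ≤ 5 * β t := min_abs_le_abs_cdf_sub (e t - μ t)
    rcases min_le_iff.1 h4 with h5 | h5
    · rw [← sq_abs]
      nlinarith [abs_nonneg (e t - μ t)]
    · linarith
  -- The constant: 25 · 320 · 8² = 512000 ≤ 720².
  refine le_of_sq_le_sq ?_ (by positivity)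
  rw [EuclideanSpace.real_norm_sq_eq]
  calc ∑ t, (e - μ) t ^ 2 ≤ ∑ t, 25 * β t ^ 2 := Finset.sum_le_sum fun t _ => hcoord t
    _ = 25 * ∑ t, β t ^ 2 := by rw [Finset.mul_sum]
    _ ≤ (720 * ε) ^ 2 := by nlinarith [sq_nonneg ε]

end Deterministic

theorem theorem4p9 :
    ∃ (ε₀ C K : ℝ) (k : ℕ), 0 < ε₀ ∧ 0 < C ∧ 0 < K ∧
      ∀ (T n : ℕ) (ε τ : ℝ), 0 < T → 0 < ε → ε ≤ ε₀ → 0 < τ → τ < 1 →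
        (2 : ℝ) ^ T * (K * (T / ε) ^ k) * Real.log (2 / τ) ≤ n →
        ∃ A : OnlineEstimator n T, ∀ μ : EuclideanSpace ℝ (Fin T),
          EstimatesMeanOnline A (multivariateGaussian μ 1) ε (C * ε) τ := by
  refine ⟨1 / 1000, 720, 5, 3, by norm_num, by norm_num, by norm_num, ?_⟩
  intro T n ε τ hT hε hε1 hτ hτ1 hn
  have hT1 : (1 : ℝ) ≤ T := by exact_mod_cast hT
  have hεn : (2 : ℝ) ^ T ≤ ε * n := by
    have hl : 1 / 2 ≤ Real.log (2 / τ) := by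
      rw [Real.log_div two_ne_zero hτ.ne']
      linarith [Real.log_neg hτ hτ1, Real.log_two_gt_d9]
    have hr : 1 / ε ≤ (T / ε) ^ 3 := by
      have h1 : 1 / ε ≤ T / ε := by gcongr
      have h2 : 1 ≤ T / ε := by rw [le_div_iff₀ hε]; linarith
      exact h1.trans (le_self_pow₀ h2 (by norm_num))
    have h1 : (2 : ℝ) ^ T * (5 * (1 / ε)) * (1 / 2) ≤ n := by
      refine le_trans ?_ hn
      gcongr
    have h2 : ε * (2 ^ T * (5 * (1 / ε)) * (1 / 2)) = 5 / 2 * 2 ^ T := by field_simp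
    have h3 := mul_le_mul_of_nonneg_left h1 hε.le
    rw [h2] at h3
    linarith [show (0 : ℝ) < 2 ^ T by positivity]
  have hn0 : 0 < n := by
    rcases Nat.eq_zero_or_pos n with rfl | h
    · have : (0 : ℝ) < 2 ^ T := by positivity
      simp at hεn
      linarith
    · exact h
  have : Nonempty (Fin n) := ⟨⟨0, hn0⟩⟩
  -- Fine enough that the overlaps of T rounds cost a factor of at most exp(ε/2) ≤ 1 + ε.
  set G := ⌈2 * T / ε⌉₊ with hGdef
  have hGl : 2 * T / ε ≤ G := Nat.le_ceil _
  have hGu : (G : ℝ) ≤ 3 * T / ε := by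
    have h1 := (Nat.ceil_lt_add_one (show 0 ≤ 2 * T / ε by positivity)).le
    have h2 : 1 ≤ T / ε := by rw [le_div_iff₀ hε]; linarith
    refine h1.trans ?_
    rw [mul_div_assoc, mul_div_assoc]
    linarith
  have hG0 : (0 : ℝ) < G := lt_of_lt_of_le (by positivity) hGl
  have hGε : (1 + 1 / (G : ℝ)) ^ T ≤ 1 + ε := by
    calc (1 + 1 / (G : ℝ)) ^ T ≤ Real.exp (1 / G) ^ T := by
          gcongr
          linarith [Real.add_one_le_exp (1 / (G : ℝ))]
      _ = Real.exp (T / G) := by rw [← Real.exp_nat_mul]; congr 1; ring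
      _ ≤ Real.exp (ε / 2) := by
          refine Real.exp_le_exp.2 ?_
          rw [div_le_iff₀ hε] at hGl
          rw [div_le_iff₀ hG0]
          linarith
      _ ≤ 1 + ε := by
          have := Real.exp_bound_div_one_sub_of_interval (x := ε / 2) (by linarith) (by linarith)
          refine this.trans ?_
          rw [div_le_iff₀ (by linarith)]
          nlinarith
  refine ⟨medianEstimator n T, fun μ => ?_⟩
  have hsub : {c | ∃ x, IsCorruption ε c x ∧ 720 * ε <
      ‖(medianEstimator n T).estimate x - ∫ y, y ∂(multivariateGaussian μ 1)‖} ⊆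
        deviationEvent μ G n ε := by
    rintro c ⟨x, hx, hlt⟩
    by_contra hc
    rw [integral_id_multivariateGaussian] at hlt
    exact absurd (norm_medianEstimator_sub_le hε hε1 (by exact_mod_cast hG0) hGε hεn hc hx)
      (not_le.2 hlt)
  refine (measure_mono hsub).trans ?_
  rw [ENNReal.le_ofReal_iff_toReal_le (measure_ne_top _ _) hτ.le]
  exact (measureReal_deviationEvent_le μ G n hε.le).trans
    (card_mul_exp_le hT hε (by linarith) hτ hτ1 hGu hn)
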